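/- For a positive integer $r$ and simple graphs $G$, $H$, let $c_{r,H}(G)$ be the number of functions $E(G)\to\{1,\dots,r\}$ (edge-colorings with $r$ colors) for which no color class contains a copy of $H$ as a (not necessarily induced) subgraph, and let $c_{r,H}(n)$ be the maximum of $c_{r,H}(G)$ over all graphs $G$ on $n$ vertices. Put $b_{r,H}=\lim_{n\to\infty}c_{r,H}(n)^{1/n}\in\mathbb{R}\cup\{\infty\}$, and let $S_3$ be the star with $3$ edges. If $r$ is a sufficiently large integer, then the limit $b_{r,S_3}$ exists and $$b_{r,S_3}\le B_r:=\left(\frac{r\,(2r-1)!^2}{2^{2r-2}}\right)^{\frac{2r-1}{8r-6}}.$$ Moreover, as $r\to\infty$, $$B_r\sim\frac{\sqrt[8]{2}}{\sqrt[4]{e}}\cdot\left(\frac{(2r)!}{2^r}\right)^{1/2},$$ that is, the ratio of the two sides tends to $1$, and $\sqrt[8]{2}/\sqrt[4]{e}\approx 0.85$ (to two decimal places). -/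

import Mathlib

open Filter Topology Asymptotics
open scoped ENNReal Nat

/-- The star `S_t` with `t` edges and `t + 1` vertices, centered at `0`. -/
def starWithEdges (t : ℕ) : SimpleGraph (Fin (t + 1)) :=
  SimpleGraph.starGraph (0 : Fin (t + 1))

/-- `c_{r,H}(G)`: the number of functions from the edges of `G` to `r` colors such that no color
class contains a (not necessarily induced) copy of `H`. -/
noncomputable def numGoodColorings {V W : Type*} (r : ℕ) (H : SimpleGraph W)
    (G : SimpleGraph V) : ℕ :=
  Nat.card {C : G.EdgeLabeling (Fin r) // ∀ i : Fin r, H.Free (C.labelGraph i)}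

/-- `c_{r,H}(n)`: the maximum of `c_{r,H}(G)` over the (finitely many) graphs `G` on the vertex
set `Fin n`. -/
noncomputable def maxGoodColorings {W : Type*} (r : ℕ) (H : SimpleGraph W) (n : ℕ) : ℕ :=
  ⨆ G : SimpleGraph (Fin n), numGoodColorings r H G

/-- The sequence `c_{r,H}(n) ^ (1/n)`, with values in `[0, ∞]`. -/
noncomputable def coloringRoot {W : Type*} (r : ℕ) (H : SimpleGraph W) (n : ℕ) : ℝ≥0∞ :=
  (maxGoodColorings r H n : ℝ≥0∞) ^ (1 / (n : ℝ))

/-- `b_{r,H}`: the limit of `c_{r,H}(n) ^ (1/n)` as `n → ∞`, possibly infinite. -/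
noncomputable def coloringGrowth {W : Type*} (r : ℕ) (H : SimpleGraph W) : ℝ≥0∞ :=
  limUnder atTop (coloringRoot r H)

/-- The real number `(r (2r-1)!² / 2^(2r-2)) ^ ((2r-1)/(8r-6))`, for `r ≥ 1`. -/
noncomputable def starThreeBound (r : ℕ) : ℝ :=
  ((r : ℝ) * ((2 * r - 1)! : ℝ) ^ 2 / 2 ^ (2 * r - 2)) ^
    ((2 * (r : ℝ) - 1) / (8 * (r : ℝ) - 6))

/-! A coloring is good exactly when every color appears at most twice at each vertex. Let S(d) be
the number of such colorings of a star with d edges. Prescribing the color of one edge divides S by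
r, so the double star at an edge uv admits at most S(d_u) S(d_v) / r good colorings.

Fractional Shearer combines these local counts. Given vertex weights a, the double star at uv gets
weight a_u + a_v, and the star at v gets the slack that makes every edge covered with total weight
exactly 1 (`log_card_le_sum`). The resulting bound splits into one term per vertex: (1/2 + a_v) log
S(d_v) - a_v d_v log r. With a constant equal to 1/(8r-6) and all degrees 2r-1, the star weights
vanish and the term is exactly log B_r, since S(2r-1) = (2r)!/2^r.

Other degrees do no better. Below 2r-1, each missing edge costs S a factor of at least 3/2, which
outweighs the log r saved. At degree 2r, where S(2r) = S(2r-1), a slightly smaller weight keeps the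
slack nonnegative, and Stirling shows that the term is still at most log B_r. Degrees above 2r allow
no good coloring.

Disjoint unions make the maximum supermultiplicative, so Fekete's lemma gives the limit. The
asymptotics of B_r are Stirling's formula. -/

/-! ### Hölder and fractional Shearer inequalities -/

/-- Hölder's inequality for finite sums and finitely many factors. -/
theorem sum_prod_rpow_le_prod_sum_rpow {J κ : Type*} (s : Finset κ) (t : Finset J) (w : J → ℝ)
    (hw : ∀ j ∈ t, 0 ≤ w j) (hw1 : ∑ j ∈ t, w j = 1) (x : J → κ → ℝ) (hx : ∀ j c, 0 ≤ x j c) :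
    ∑ c ∈ s, ∏ j ∈ t, x j c ^ w j ≤ ∏ j ∈ t, (∑ c ∈ s, x j c) ^ w j := by
  have hX : ∀ j, 0 ≤ ∑ c ∈ s, x j c := fun j => Finset.sum_nonneg fun c _ => hx j c
  -- Normalizing each factor to total 1 reduces the claim to weighted AM-GM. A zero total is
  -- harmless: its terms all vanish, and division by zero gives 0.
  have key : ∀ c ∈ s, ∏ j ∈ t, x j c ^ w j =
      (∏ j ∈ t, (∑ c ∈ s, x j c) ^ w j) * ∏ j ∈ t, (x j c / ∑ c ∈ s, x j c) ^ w j := by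
    intro c hc
    rw [← Finset.prod_mul_distrib]
    refine Finset.prod_congr rfl fun j _ => ?_
    rw [← Real.mul_rpow (hX j) (div_nonneg (hx j c) (hX j))]
    congr 1
    by_cases h : ∑ c ∈ s, x j c = 0
    · rw [h, zero_mul]
      exact (Finset.sum_eq_zero_iff_of_nonneg fun c _ => hx j c).1 h c hc
    · field_simp
  rw [Finset.sum_congr rfl key, ← Finset.mul_sum]
  refine mul_le_of_le_one_right
    (Finset.prod_nonneg fun j _ => Real.rpow_nonneg (hX j) _) ?_
  calc ∑ c ∈ s, ∏ j ∈ t, (x j c / ∑ c ∈ s, x j c) ^ w j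
      ≤ ∑ c ∈ s, ∑ j ∈ t, w j * (x j c / ∑ c ∈ s, x j c) :=
        Finset.sum_le_sum fun c _ => Real.geom_mean_le_arith_mean_weighted t w _ hw hw1
          fun j _ => div_nonneg (hx j c) (hX j)
    _ = ∑ j ∈ t, w j * ((∑ c ∈ s, x j c) / ∑ c ∈ s, x j c) := by
        rw [Finset.sum_comm]
        refine Finset.sum_congr rfl fun j _ => ?_
        rw [← Finset.mul_sum, Finset.sum_div]
    _ ≤ ∑ j ∈ t, w j :=
        Finset.sum_le_sum fun j hj => mul_le_of_le_one_right (hw j hj) (div_self_le_one _)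
    _ = 1 := hw1

/-- Fractional form of Shearer's lemma, for families that are constant outside of `U`. -/
theorem card_le_prod_card_image_restrict_rpow_of_eqOn {ι κ J : Type*} [DecidableEq ι]
    [DecidableEq κ] (A : J → Finset ι) (t : Finset J) (w : J → ℝ) (hw : ∀ j ∈ t, 0 ≤ w j)
    (U : Finset ι) : ∀ F : Finset (ι → κ),
      (∀ f ∈ F, ∀ g ∈ F, ∀ i ∉ U, f i = g i) →
      (∀ i ∈ U, ∑ j ∈ t with i ∈ A j, w j = 1) →
      (F.card : ℝ) ≤ ∏ j ∈ t, ((F.image (A j).restrict).card : ℝ) ^ w j := by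
  induction U using Finset.induction_on with
  | empty =>
    intro F hF _
    rcases F.eq_empty_or_nonempty with rfl | hne
    · simp only [Finset.card_empty, Nat.cast_zero]
      exact Finset.prod_nonneg fun j _ => Real.rpow_nonneg (Nat.cast_nonneg _) _
    · have h1 : F.card ≤ 1 := Finset.card_le_one.2 fun f hf g hg =>
        funext fun i => hF f hf g hg i (Finset.notMem_empty i)
      calc (F.card : ℝ) ≤ ∏ j ∈ t, (1 : ℝ) := by
            rw [Finset.prod_const_one]; exact_mod_cast h1
        _ ≤ _ := Finset.prod_le_prod (fun _ _ => zero_le_one) fun j hj => ?_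
      exact Real.one_le_rpow (by exact_mod_cast (hne.image _).card_pos) (hw j hj)
  | insert i U hi ih =>
    intro F hF hcov
    set P : J → ℝ := fun j => ((F.image (A j).restrict).card : ℝ)
    set x : J → κ → ℝ := fun j c => (((F.filter fun f => f i = c).image (A j).restrict).card : ℝ)
    have hle : ∀ j c, x j c ≤ P j := fun j c => 
      Nat.cast_le.2 (Finset.card_le_card (Finset.image_subset_image (Finset.filter_subset _ _)))
    -- If `A j` contains `i`, restrictions from different fibers differ at `i`, so their images are
    -- disjoint.
    have hsum : ∀ j, i ∈ A j → ∑ c ∈ F.image (fun f => f i), x j c ≤ P j := by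
      intro j hj
      have hd : Set.PairwiseDisjoint (F.image (fun f => f i) : Set κ)
          (fun c => (F.filter fun f => f i = c).image (A j).restrict) := by
        intro c _ c' _ hcc
        refine Finset.disjoint_left.2 fun g hg hg' => hcc ?_
        obtain ⟨f, hf, rfl⟩ := Finset.mem_image.1 hg
        obtain ⟨f', hf', he⟩ := Finset.mem_image.1 hg'
        rw [← (Finset.mem_filter.1 hf).2, ← (Finset.mem_filter.1 hf').2]
        exact (congrFun he ⟨i, hj⟩).symm
      simp only [x, P]
      rw [← Nat.cast_sum, ← Finset.card_biUnion hd]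
      refine Nat.cast_le.2 (Finset.card_le_card (Finset.biUnion_subset.2 fun c _ => ?_))
      exact Finset.image_subset_image (Finset.filter_subset _ _)
    -- A fiber is constant also at `i`, so induction applies to it. Factors not seeing `i` are
    -- bounded by their values for all of `F`; Hölder sums the others over `c`.
    have hstep : ∀ c, ((F.filter fun f => f i = c).card : ℝ) ≤
        (∏ j ∈ t with i ∈ A j, x j c ^ w j) * ∏ j ∈ t with i ∉ A j, P j ^ w j := by
      intro c
      refine (ih _ ?_ fun k hk => hcov k (Finset.mem_insert_of_mem hk)).trans ?_
      · intro f hf g hg k hk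
        rw [Finset.mem_filter] at hf hg
        by_cases hki : k = i
        · rw [hki, hf.2, hg.2]
        · exact hF f hf.1 g hg.1 k (by simp [hki, hk])
      · rw [← Finset.prod_filter_mul_prod_filter_not t (fun j => i ∈ A j)]
        refine mul_le_mul_of_nonneg_left ?_
          (Finset.prod_nonneg fun j _ => Real.rpow_nonneg (Nat.cast_nonneg _) _)
        refine Finset.prod_le_prod (fun j _ => Real.rpow_nonneg (Nat.cast_nonneg _) _) ?_
        intro j hj
        exact Real.rpow_le_rpow (Nat.cast_nonneg _) (hle j c) (hw j (Finset.mem_filter.1 hj).1)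
    calc (F.card : ℝ) = ∑ c ∈ F.image (fun f => f i), ((F.filter fun f => f i = c).card : ℝ) := by
          rw [← Nat.cast_sum, Finset.card_eq_sum_card_image (fun f => f i)]
      _ ≤ ∑ c ∈ F.image (fun f => f i),
          (∏ j ∈ t with i ∈ A j, x j c ^ w j) * ∏ j ∈ t with i ∉ A j, P j ^ w j :=
        Finset.sum_le_sum fun c _ => hstep c
      _ ≤ (∏ j ∈ t with i ∈ A j, P j ^ w j) * ∏ j ∈ t with i ∉ A j, P j ^ w j := by
        rw [← Finset.sum_mul]
        refine mul_le_mul_of_nonneg_right ?_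
          (Finset.prod_nonneg fun j _ => Real.rpow_nonneg (Nat.cast_nonneg _) _)
        refine (sum_prod_rpow_le_prod_sum_rpow _ _ w
          (fun j hj => hw j (Finset.mem_filter.1 hj).1) (hcov i (Finset.mem_insert_self _ _)) x
          fun j c => Nat.cast_nonneg _).trans ?_
        refine Finset.prod_le_prod (fun j _ => Real.rpow_nonneg
          (Finset.sum_nonneg fun c _ => Nat.cast_nonneg _) _) fun j hj => ?_
        rw [Finset.mem_filter] at hj
        exact Real.rpow_le_rpow (Finset.sum_nonneg fun c _ => Nat.cast_nonneg _) (hsum j hj.2)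
          (hw j hj.1)
      _ = ∏ j ∈ t, P j ^ w j := Finset.prod_filter_mul_prod_filter_not _ _ _

/-- Fractional form of Shearer's lemma. -/
theorem card_le_prod_card_image_restrict_rpow {ι κ J : Type*} [Fintype ι] [DecidableEq ι]
    [DecidableEq κ] (A : J → Finset ι) (t : Finset J) (w : J → ℝ) (hw : ∀ j ∈ t, 0 ≤ w j)
    (hcov : ∀ i, ∑ j ∈ t with i ∈ A j, w j = 1) (F : Finset (ι → κ)) :
    (F.card : ℝ) ≤ ∏ j ∈ t, ((F.image (A j).restrict).card : ℝ) ^ w j :=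
  card_le_prod_card_image_restrict_rpow_of_eqOn A t w hw Finset.univ F
    (fun _ _ _ _ i hi => absurd (Finset.mem_univ i) hi) fun i _ => hcov i

/-! ### Counting functions with every value at most twice -/

/-- The functions `X → K` taking every value at most twice. -/
def atMostTwice (X K : Type*) [Fintype X] [Fintype K] [DecidableEq X] [DecidableEq K] :
    Finset (X → K) :=
  {f | ∀ c, (Finset.univ.filter fun x => f x = c).card ≤ 2}

/-- The number of functions `Fin d → Fin r` taking every value at most twice. -/
def numAtMostTwice (r d : ℕ) : ℕ := (atMostTwice (Fin d) (Fin r)).card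

section
variable {X K : Type*} [Fintype X] [Fintype K] [DecidableEq K]

theorem sum_card_fiber (f : X → K) :
    ∑ c, (Finset.univ.filter fun x => f x = c).card = Fintype.card X :=
  (Finset.card_eq_sum_card_fiberwise (fun _ _ => Finset.mem_coe.2 (Finset.mem_univ _))).symm

/-- The values that a function takes at most once. -/
def freeValues (f : X → K) : Finset K :=
  Finset.univ.filter fun c => (Finset.univ.filter fun x => f x = c).card ≤ 1

theorem mem_freeValues {f : X → K} {c : K} :
    c ∈ freeValues f ↔ (Finset.univ.filter fun x => f x = c).card ≤ 1 := by
  simp [freeValues]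

theorem sum_deficit_eq_sum_freeValues {f : X → K} :
    ∑ c, (2 - (Finset.univ.filter fun x => f x = c).card) =
      ∑ c ∈ freeValues f, (2 - (Finset.univ.filter fun x => f x = c).card) := by
  refine (Finset.sum_subset (Finset.subset_univ _) fun c _ hc => ?_).symm
  rw [mem_freeValues] at hc
  omega

end

section
variable {X Y K : Type*} [Fintype X] [Fintype Y] [Fintype K] [DecidableEq X] [DecidableEq Y]
  [DecidableEq K]

theorem mem_atMostTwice {f : X → K} :
    f ∈ atMostTwice X K ↔ ∀ c, (Finset.univ.filter fun x => f x = c).card ≤ 2 := by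
  simp [atMostTwice]

theorem comp_mem_atMostTwice {f : X → K} (hf : f ∈ atMostTwice X K) {e : Y → X}
    (he : Function.Injective e) : f ∘ e ∈ atMostTwice Y K := by
  rw [mem_atMostTwice] at hf ⊢
  intro c
  refine le_trans (Finset.card_le_card_of_injOn e ?_ he.injOn) (hf c)
  intro y hy
  simpa using hy

theorem equiv_comp_mem_atMostTwice {f : X → K} (hf : f ∈ atMostTwice X K) (e : Equiv.Perm K) :
    e ∘ f ∈ atMostTwice X K := by
  rw [mem_atMostTwice] at hf ⊢
  intro c
  simpa [Equiv.eq_symm_apply] using hf (e.symm c)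

theorem card_atMostTwice_congr (e : X ≃ Y) :
    (atMostTwice X K).card = (atMostTwice Y K).card :=
  Finset.card_bij' (fun f _ => f ∘ e.symm) (fun f _ => f ∘ e)
    (fun _ hf => comp_mem_atMostTwice hf e.symm.injective)
    (fun _ hf => comp_mem_atMostTwice hf e.injective)
    (fun f _ => by ext x; simp) (fun f _ => by ext x; simp)

theorem card_atMostTwice (r : ℕ) :
    (atMostTwice X (Fin r)).card = numAtMostTwice r (Fintype.card X) :=
  card_atMostTwice_congr (Fintype.equivFin X)

/-- By symmetry, prescribing one value divides the number of functions by the number of values. -/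
theorem card_filter_apply_eq_mul_card (x : X) (c : K) :
    ((atMostTwice X K).filter fun f => f x = c).card * Fintype.card K =
      (atMostTwice X K).card := by
  have h : ∀ c', ((atMostTwice X K).filter fun f => f x = c').card =
      ((atMostTwice X K).filter fun f => f x = c).card := by
    intro c'
    refine Finset.card_bij' (fun f _ => Equiv.swap c c' ∘ f) (fun f _ => Equiv.swap c c' ∘ f)
      ?_ ?_ ?_ ?_
    · intro f hf
      rw [Finset.mem_filter] at hf ⊢
      exact ⟨equiv_comp_mem_atMostTwice hf.1 _, by simp [hf.2]⟩
    · intro f hf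
      rw [Finset.mem_filter] at hf ⊢
      exact ⟨equiv_comp_mem_atMostTwice hf.1 _, by simp [hf.2]⟩
    · intro f _; ext y; simp
    · intro f _; ext y; simp
  rw [Finset.card_eq_sum_card_fiberwise (s := atMostTwice X K) (f := fun f => f x)
    (t := Finset.univ) (fun _ _ => Finset.mem_coe.2 (Finset.mem_univ _)), Finset.sum_congr rfl fun c' _ => h c']
  simp [mul_comm]

/-- Fix the common value and apply the one-point symmetry in the second factor. This counts pairs of
star colorings that agree on a shared edge. -/
theorem card_filter_apply_eq_apply_mul_card (x : X) (y : Y) :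
    ((atMostTwice X K ×ˢ atMostTwice Y K).filter fun p => p.1 x = p.2 y).card *
      Fintype.card K = (atMostTwice X K).card * (atMostTwice Y K).card := by
  rw [Finset.card_eq_sum_card_fiberwise (f := fun p : (X → K) × (Y → K) => p.1 x)
    (t := Finset.univ) (fun _ _ => Finset.mem_coe.2 (Finset.mem_univ _)), Finset.sum_mul,
    Finset.card_eq_sum_card_fiberwise (s := atMostTwice X K) (f := fun f => f x)
    (t := Finset.univ) (fun _ _ => Finset.mem_coe.2 (Finset.mem_univ _)), Finset.sum_mul]
  refine Finset.sum_congr rfl fun c _ => ?_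
  rw [← card_filter_apply_eq_mul_card y c, ← mul_assoc, ← Finset.card_product]
  congr 2
  ext p
  simp only [Finset.mem_filter, Finset.mem_product]
  constructor
  · rintro ⟨⟨⟨h1, h2⟩, h3⟩, h4⟩
    exact ⟨⟨h1, h4⟩, h2, h3 ▸ h4⟩
  · rintro ⟨⟨h1, h4⟩, h2, h3⟩
    exact ⟨⟨⟨h1, h2⟩, h4.trans h3.symm⟩, h4⟩

theorem sum_deficit {f : X → K} (hf : f ∈ atMostTwice X K) :
    ∑ c, (2 - (Finset.univ.filter fun x => f x = c).card) + Fintype.card X =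
      2 * Fintype.card K := by
  rw [← sum_card_fiber f, ← Finset.sum_add_distrib, Finset.sum_congr rfl fun c _ =>
    Nat.sub_add_cancel (mem_atMostTwice.1 hf c)]
  simp [mul_comm]

/-- The total deficit from 2 is carried by the free values, each contributing at most 2; the
companion bound below uses that each contributes at least 1. -/
theorem card_le_two_mul_card_freeValues {f : X → K} (hf : f ∈ atMostTwice X K) :
    2 * Fintype.card K ≤ 2 * (freeValues f).card + Fintype.card X := by
  rw [← sum_deficit hf, sum_deficit_eq_sum_freeValues]
  refine Nat.add_le_add_right ((Finset.sum_le_card_nsmul _ _ 2 fun c _ => by omega).trans ?_) _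
  simp [mul_comm]

theorem card_freeValues_le {f : X → K} (hf : f ∈ atMostTwice X K) :
    (freeValues f).card + Fintype.card X ≤ 2 * Fintype.card K := by
  rw [← sum_deficit hf, sum_deficit_eq_sum_freeValues]
  refine Nat.add_le_add_right ?_ _
  rw [Finset.card_eq_sum_ones]
  refine Finset.sum_le_sum fun c hc => ?_
  rw [mem_freeValues] at hc
  omega

end

theorem card_fiber_cons {r d : ℕ} (c : Fin r) (f : Fin d → Fin r) (a : Fin r) :
    (Finset.univ.filter fun x => (Fin.cons c f : Fin (d + 1) → Fin r) x = a).card =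
      (if c = a then 1 else 0) + (Finset.univ.filter fun x => f x = a).card := by
  rw [Fin.card_filter_univ_succ]
  simp only [Fin.cons_zero, Fin.cons_succ]
  split_ifs <;> simp [add_comm]

theorem cons_mem_atMostTwice {r d : ℕ} {c : Fin r} {f : Fin d → Fin r} :
    (Fin.cons c f : Fin (d + 1) → Fin r) ∈ atMostTwice (Fin (d + 1)) (Fin r) ↔
      f ∈ atMostTwice (Fin d) (Fin r) ∧ c ∈ freeValues f := by
  simp only [mem_atMostTwice, mem_freeValues, card_fiber_cons]
  constructor
  · intro h
    refine ⟨fun a => le_trans (Nat.le_add_left _ _) (h a), ?_⟩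
    have := h c
    rw [if_pos rfl] at this
    omega
  · rintro ⟨h, hc⟩ a
    split_ifs with hca
    · subst hca; omega
    · have := h a; omega

theorem numAtMostTwice_succ (r d : ℕ) :
    numAtMostTwice r (d + 1) = ∑ f ∈ atMostTwice (Fin d) (Fin r), (freeValues f).card := by
  rw [numAtMostTwice, ← Finset.card_sigma]
  refine (Finset.card_bij' (fun p _ => (Fin.cons p.2 p.1 : Fin (d + 1) → Fin r))
    (fun g _ => ⟨Fin.tail g, g 0⟩) ?_ ?_ ?_ ?_).symm
  · rintro ⟨f, c⟩ h
    exact cons_mem_atMostTwice.2 (Finset.mem_sigma.1 h)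
  · intro g hg
    rw [← Fin.cons_self_tail g] at hg
    exact Finset.mem_sigma.2 (cons_mem_atMostTwice.1 hg)
  · rintro ⟨f, c⟩ _; simp
  · intro g _; simp

/-- There are equally many functions of length `2r - 1` and of length `2r`. -/
theorem numAtMostTwice_two_mul {r : ℕ} (hr : 1 ≤ r) :
    numAtMostTwice r (2 * r) = numAtMostTwice r (2 * r - 1) := by
  obtain ⟨m, rfl⟩ : ∃ m, r = m + 1 := ⟨r - 1, by omega⟩
  rw [show 2 * (m + 1) = (2 * m + 1) + 1 by ring, Nat.add_sub_cancel, numAtMostTwice_succ,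
    numAtMostTwice, Finset.card_eq_sum_ones]
  refine Finset.sum_congr rfl fun f hf => ?_
  -- At length 2r-1 the two bounds leave exactly one free value, so the last entry is forced.
  have h1 := card_le_two_mul_card_freeValues hf
  have h2 := card_freeValues_le hf
  simp only [Fintype.card_fin] at h1 h2
  omega

/-- A function `f` with a unique value taken at most once, of length `2r - 2`, misses that value
and takes every other value exactly twice. -/
theorem exists_missing_value {r d : ℕ} (hd : d + 2 = 2 * r) {f : Fin d → Fin r}
    (hf : f ∈ atMostTwice (Fin d) (Fin r)) (h1 : (freeValues f).card = 1) :
    ∃ m, (∀ x, f x ≠ m) ∧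
      ∀ c, c ≠ m → (Finset.univ.filter fun x => f x = c).card = 2 := by
  obtain ⟨m, hm⟩ := Finset.card_eq_one.1 h1
  have hs := sum_deficit hf
  rw [sum_deficit_eq_sum_freeValues, hm, Finset.sum_singleton] at hs
  simp only [Fintype.card_fin] at hs
  refine ⟨m, ?_, fun c hc => ?_⟩
  · have h0 : (Finset.univ.filter fun x => f x = m).card = 0 := by omega
    intro x hx
    rw [Finset.card_eq_zero] at h0
    exact (Finset.eq_empty_iff_forall_notMem.1 h0) x (by simp [hx])
  · have h2 := mem_atMostTwice.1 hf c
    have h3 : c ∉ freeValues f := by rw [hm]; simpa using hc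
    rw [mem_freeValues] at h3
    omega

/-- Overwriting the entry at 0 with the missing value leaves both that value and the old entry used
once, hence two free values. The overwriting is injective. -/
theorem card_freeValues_eq_one_le {r d : ℕ} (hd : d + 3 = 2 * r) :
    ((atMostTwice (Fin (d + 1)) (Fin r)).filter fun f => (freeValues f).card = 1).card ≤
      ((atMostTwice (Fin (d + 1)) (Fin r)).filter fun f => (freeValues f).card ≠ 1).card := by
  classical
  have hex : ∀ f : Fin (d + 1) → Fin r, ∃ m, f ∈ (atMostTwice (Fin (d + 1)) (Fin r)).filter
      (fun f => (freeValues f).card = 1) → (∀ x, f x ≠ m) ∧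
        ∀ c, c ≠ m → (Finset.univ.filter fun x => f x = c).card = 2 := by
    intro f
    by_cases hf : f ∈ (atMostTwice (Fin (d + 1)) (Fin r)).filter
      (fun f => (freeValues f).card = 1)
    · obtain ⟨hf1, hf2⟩ := Finset.mem_filter.1 hf
      obtain ⟨m, hm⟩ := exists_missing_value (by omega) hf1 hf2
      exact ⟨m, fun _ => hm⟩
    -- A dummy choice outside the relevant family.
    · exact ⟨f 0, fun h => absurd h hf⟩
  choose miss hmiss using hex
  have hcount : ∀ (f : Fin (d + 1) → Fin r) (a : Fin r),
      (Finset.univ.filter fun x => f x = a).card =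
        (if f 0 = a then 1 else 0) + (Finset.univ.filter fun x => Fin.tail f x = a).card := by
    intro f a
    rw [← card_fiber_cons, Fin.cons_self_tail]
  refine Finset.card_le_card_of_injOn
    (fun f => (Fin.cons (miss f) (Fin.tail f) : Fin (d + 1) → Fin r)) ?_ ?_
  · intro f hf
    obtain ⟨hm1, hm2⟩ := hmiss f (Finset.mem_coe.1 hf)
    rw [Finset.mem_coe, Finset.mem_filter] at hf
    have hne : f 0 ≠ miss f := hm1 0
    have hmz : (Finset.univ.filter fun x => Fin.tail f x = miss f).card = 0 := by
      rw [Finset.card_eq_zero, Finset.filter_eq_empty_iff]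
      exact fun x _ => hm1 _
    have hc := hcount f (f 0)
    rw [if_pos rfl, hm2 _ hne] at hc
    have hmem : (Fin.cons (miss f) (Fin.tail f) : Fin (d + 1) → Fin r) ∈
        atMostTwice (Fin (d + 1)) (Fin r) := by
      rw [mem_atMostTwice]
      intro a
      rw [card_fiber_cons]
      have ha := hcount f a
      have ha2 := mem_atMostTwice.1 hf.1 a
      split_ifs with h
      · rw [← h, hmz]; omega
      · omega
    rw [Finset.mem_coe, Finset.mem_filter]
    refine ⟨hmem, ne_of_gt ?_⟩
    have hsub : {miss f, f 0} ⊆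
        freeValues (Fin.cons (miss f) (Fin.tail f) : Fin (d + 1) → Fin r) := by
      intro a ha
      rw [mem_freeValues, card_fiber_cons]
      rw [Finset.mem_insert, Finset.mem_singleton] at ha
      rcases ha with rfl | rfl
      · rw [hmz]; simp
      · rw [if_neg hne.symm]; omega
    have := Finset.card_le_card hsub
    rwa [Finset.card_pair hne.symm] at this
  · intro f hf g hg hfg
    obtain ⟨hf1, hf2⟩ := hmiss f (Finset.mem_coe.1 hf)
    obtain ⟨hg1, hg2⟩ := hmiss g (Finset.mem_coe.1 hg)
    obtain ⟨hm, ht⟩ := Fin.cons_inj.1 hfg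
    -- Otherwise the common tail would take the value `g 0` twice, judged from `f`, but only once,
    -- judged from `g`.
    have h0 : f 0 = g 0 := by
      by_contra hne
      have e1 := hcount f (g 0)
      have e2 := hcount g (g 0)
      rw [if_neg hne, hf2 (g 0) (by rw [hm]; exact hg1 0), ht] at e1
      rw [if_pos rfl, hg2 (g 0) (hg1 0)] at e2
      omega
    rw [← Fin.cons_self_tail f, ← Fin.cons_self_tail g, h0, ht]

/-- The average number of free values is at least 3/2. For lengths below 2r-2 every function has at
least two; at 2r-2 at most half of them have only one. -/
theorem three_mul_numAtMostTwice_le {r d : ℕ} (hd : d + 2 ≤ 2 * r) (hr : 2 ≤ r) :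
    3 * numAtMostTwice r d ≤ 2 * numAtMostTwice r (d + 1) := by
  rw [numAtMostTwice_succ]
  rcases Nat.lt_or_ge (d + 2) (2 * r) with h | h
  · have : ∑ f ∈ atMostTwice (Fin d) (Fin r), 2 ≤
        ∑ f ∈ atMostTwice (Fin d) (Fin r), (freeValues f).card := by
      refine Finset.sum_le_sum fun f hf => ?_
      have h1 := card_le_two_mul_card_freeValues hf
      simp only [Fintype.card_fin] at h1
      omega
    rw [Finset.sum_const, smul_eq_mul, ← numAtMostTwice] at this
    omega
  · obtain ⟨d, rfl⟩ : ∃ e, d = e + 1 := ⟨d - 1, by omega⟩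
    have hb := card_freeValues_eq_one_le (r := r) (d := d) (by omega)
    rw [numAtMostTwice, ← Finset.sum_filter_add_sum_filter_not _
      (fun f => (freeValues f).card = 1) (fun f => (freeValues f).card),
      ← Finset.card_filter_add_card_filter_not (fun f => (freeValues f).card = 1)]
    have h1 : ∑ f ∈ (atMostTwice (Fin (d + 1)) (Fin r)).filter
        (fun f => (freeValues f).card = 1), (freeValues f).card =
        ((atMostTwice (Fin (d + 1)) (Fin r)).filter fun f => (freeValues f).card = 1).card := by
      rw [Finset.card_eq_sum_ones]
      exact Finset.sum_congr rfl fun f hf => (Finset.mem_filter.1 hf).2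
    have h2 : ((atMostTwice (Fin (d + 1)) (Fin r)).filter
        (fun f => ¬(freeValues f).card = 1)).card * 2 ≤ ∑ f ∈ (atMostTwice (Fin (d + 1))
        (Fin r)).filter (fun f => ¬(freeValues f).card = 1), (freeValues f).card := by
      rw [← smul_eq_mul]
      refine Finset.card_nsmul_le_sum _ _ _ fun f hf => ?_
      rw [Finset.mem_filter] at hf
      have h1 := card_le_two_mul_card_freeValues hf.1
      simp only [Fintype.card_fin] at h1
      omega
    simp only [ne_eq] at hb
    omega

/-- Shortening the functions decreases their number geometrically. -/
theorem numAtMostTwice_mul_pow_le {r d : ℕ} (k : ℕ) (hd : d + k + 1 ≤ 2 * r) (hr : 2 ≤ r) :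
    (numAtMostTwice r d : ℝ) * (3 / 2) ^ k ≤ numAtMostTwice r (d + k) := by
  induction k with
  | zero => simp
  | succ k ih =>
    have h := three_mul_numAtMostTwice_le (r := r) (d := d + k) (by omega) hr
    have h' : (3 : ℝ) * numAtMostTwice r (d + k) ≤ 2 * numAtMostTwice r (d + (k + 1)) := by
      exact_mod_cast h
    have := ih (by omega)
    rw [pow_succ]
    linarith

theorem card_fiber_eq_two {X K : Type*} [Fintype X] [Fintype K] [DecidableEq X] [DecidableEq K]
    (hX : Fintype.card X = 2 * Fintype.card K) {f : X → K} (hf : f ∈ atMostTwice X K) (c : K) :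
    (Finset.univ.filter fun x => f x = c).card = 2 := by
  have h := sum_deficit hf
  have h0 : ∑ c, (2 - (Finset.univ.filter fun x => f x = c).card) = 0 := by omega
  have h1 := Finset.sum_eq_zero_iff.1 h0 c (Finset.mem_univ c)
  have h2 := mem_atMostTwice.1 hf c
  omega

/-- The permutations carrying `f` to `g` form a coset of the stabilizer of `f`, a product of copies
of S_2, one per value. -/
theorem card_perm_comp_eq {X K : Type*} [Fintype X] [Fintype K] [DecidableEq X] [DecidableEq K]
    (hX : Fintype.card X = 2 * Fintype.card K) {f g : X → K} (hf : f ∈ atMostTwice X K)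
    (hg : g ∈ atMostTwice X K) :
    (Finset.univ.filter fun σ : Equiv.Perm X => f ∘ σ = g).card = 2 ^ Fintype.card K := by
  have hs := DomMulAct.stabilizer_card f
  rw [Finset.prod_congr rfl fun c _ => by
    rw [Fintype.card_subtype, card_fiber_eq_two hX hf c, Nat.factorial_two]] at hs
  rw [Finset.prod_const, Finset.card_univ, Fintype.card_subtype] at hs
  rw [← hs]
  have he : ∀ c, Nonempty ({x // g x = c} ≃ {x // f x = c}) := fun c => by
    refine ⟨Fintype.equivOfCardEq ?_⟩
    rw [Fintype.card_subtype, Fintype.card_subtype, card_fiber_eq_two hX hf,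
      card_fiber_eq_two hX hg]
  set τ : Equiv.Perm X := Equiv.ofFiberEquiv fun c => (he c).some
  have hτ : f ∘ τ = g := funext fun x => Equiv.ofFiberEquiv_map _ x
  refine Finset.card_bij' (fun σ _ => τ⁻¹.trans σ) (fun σ _ => τ.trans σ) ?_ ?_ ?_ ?_
  · intro σ hσ
    simp only [Finset.mem_filter, Finset.mem_univ, true_and] at hσ ⊢
    rw [Equiv.coe_trans, ← Function.comp_assoc, hσ, ← hτ]
    ext x; simp
  · intro σ hσ
    simp only [Finset.mem_filter, Finset.mem_univ, true_and] at hσ ⊢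
    rw [Equiv.coe_trans, ← Function.comp_assoc, hσ, hτ]
  · intro σ _; ext x; simp
  · intro σ _; ext x; simp

/-- The number of functions taking each of `r` values exactly twice. -/
theorem numAtMostTwice_two_mul_mul_pow (r : ℕ) : numAtMostTwice r (2 * r) * 2 ^ r = (2 * r)! := by
  have hX : Fintype.card (Fin r × Fin 2) = 2 * r := by simp [mul_comm]
  have hX' : Fintype.card (Fin r × Fin 2) = 2 * Fintype.card (Fin r) := by simp [mul_comm]
  have hf : (Prod.fst : Fin r × Fin 2 → Fin r) ∈ atMostTwice (Fin r × Fin 2) (Fin r) := by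
    rw [mem_atMostTwice]
    intro c
    refine (Finset.card_le_card_of_injOn (t := (Finset.univ : Finset (Fin 2))) Prod.snd
      (by simp) ?_).trans (by simp)
    rintro ⟨a, b⟩ h ⟨a', b'⟩ h' hb
    simp_all
  have h := Finset.card_eq_sum_card_fiberwise
    (s := (Finset.univ : Finset (Equiv.Perm (Fin r × Fin 2))))
    (t := atMostTwice (Fin r × Fin 2) (Fin r)) (f := fun σ : Equiv.Perm _ => Prod.fst ∘ σ)
    (fun σ _ => comp_mem_atMostTwice hf σ.injective)
  rw [Finset.sum_congr rfl fun g hg => card_perm_comp_eq hX' hf hg, Finset.card_univ,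
    Fintype.card_perm, hX, Finset.sum_const, card_atMostTwice, hX, smul_eq_mul,
    Fintype.card_fin] at h
  exact h.symm

/-! ### Shearer's lemma on stars and double stars -/

theorem filter_mem_edge {V : Type*} [Fintype V] [DecidableEq V] {G : SimpleGraph V}
    {u v : V} (h : s(u, v) ∈ G.edgeSet) :
    (Finset.univ.filter fun x => x ∈ (⟨s(u, v), h⟩ : G.edgeSet).1) = {u, v} := by
  ext x; simp

theorem sum_mem_edge {V : Type*} [Fintype V] [DecidableEq V] {G : SimpleGraph V}
    {u v : V} (h : s(u, v) ∈ G.edgeSet) (p : V → ℝ) :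
    ∑ x with x ∈ (⟨s(u, v), h⟩ : G.edgeSet).1, p x = p u + p v := by
  rw [filter_mem_edge, Finset.sum_pair (G.ne_of_adj h)]

section
variable {V : Type*} [Fintype V] [DecidableEq V] (G : SimpleGraph V) [DecidableRel G.Adj]

/-- The edges at a vertex, as a set of elements of the edge set. -/
def edgesAt (v : V) : Finset G.edgeSet := Finset.univ.filter fun e => v ∈ e.1

/-- The edges meeting a given edge, including the edge itself. -/
def edgesMeeting (e : G.edgeSet) : Finset G.edgeSet :=
  Finset.univ.filter fun e' => ∃ v ∈ e.1, v ∈ e'.1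

variable {G}

theorem mem_edgesAt {v : V} {e : G.edgeSet} : e ∈ edgesAt G v ↔ v ∈ e.1 := by simp [edgesAt]

theorem mem_edgesMeeting {e e' : G.edgeSet} :
    e' ∈ edgesMeeting G e ↔ ∃ v ∈ e.1, v ∈ e'.1 := by simp [edgesMeeting]

theorem card_edgesAt (v : V) : (edgesAt G v).card = G.degree v := by
  rw [← G.card_incidenceFinset_eq_degree]
  refine Finset.card_bij (fun e _ => e.1) ?_ (fun _ _ _ _ h => Subtype.ext h) ?_
  · intro e he
    rw [SimpleGraph.mem_incidenceFinset]
    exact ⟨e.2, mem_edgesAt.1 he⟩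
  · intro e he
    rw [SimpleGraph.mem_incidenceFinset] at he
    exact ⟨⟨e, he.1⟩, mem_edgesAt.2 he.2, rfl⟩

theorem edgesMeeting_eq {u v : V} (h : s(u, v) ∈ G.edgeSet) :
    edgesMeeting G ⟨s(u, v), h⟩ = edgesAt G u ∪ edgesAt G v := by
  ext e; simp [mem_edgesMeeting, mem_edgesAt]

theorem edgesAt_inter {u v : V} (h : s(u, v) ∈ G.edgeSet) :
    edgesAt G u ∩ edgesAt G v = {⟨s(u, v), h⟩} := by
  ext e
  rw [Finset.mem_inter, mem_edgesAt, mem_edgesAt, Finset.mem_singleton,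
    Sym2.mem_and_mem_iff (G.ne_of_adj h), Subtype.ext_iff]

theorem sum_edges_sum_mem (p : G.edgeSet → V → ℝ) :
    ∑ e, ∑ v with v ∈ e.1, p e v = ∑ v, ∑ e ∈ edgesAt G v, p e v := by
  simp only [edgesAt, Finset.sum_filter]
  exact Finset.sum_comm

/-- The restrictions to the edges at a vertex. -/
theorem card_image_restrict_edgesAt_le {r : ℕ} {F : Finset (G.edgeSet → Fin r)} {v : V}
    (hF : ∀ f ∈ F, (edgesAt G v).restrict f ∈ atMostTwice (edgesAt G v) (Fin r)) :
    (F.image (edgesAt G v).restrict).card ≤ numAtMostTwice r (G.degree v) := by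
  have h := card_atMostTwice (X := edgesAt G v) r
  rw [Fintype.card_coe, card_edgesAt] at h
  rw [← h]
  exact Finset.card_le_card (Finset.image_subset_iff.2 hF)

/-- The restrictions to the edges meeting a given edge. -/
theorem card_image_restrict_edgesMeeting_le {r : ℕ} {F : Finset (G.edgeSet → Fin r)}
    (hF : ∀ f ∈ F, ∀ v, (edgesAt G v).restrict f ∈ atMostTwice (edgesAt G v) (Fin r))
    {u v : V} (h : s(u, v) ∈ G.edgeSet) :
    (F.image (edgesMeeting G ⟨s(u, v), h⟩).restrict).card * r ≤
      numAtMostTwice r (G.degree u) * numAtMostTwice r (G.degree v) := by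
  set e : G.edgeSet := ⟨s(u, v), h⟩
  have hu : e ∈ edgesAt G u := mem_edgesAt.2 (Sym2.mem_mk_left u v)
  have hv : e ∈ edgesAt G v := mem_edgesAt.2 (Sym2.mem_mk_right u v)
  have hsu : edgesAt G u ⊆ edgesMeeting G e := by
    rw [edgesMeeting_eq h]; exact Finset.subset_union_left
  have hsv : edgesAt G v ⊆ edgesMeeting G e := by
    rw [edgesMeeting_eq h]; exact Finset.subset_union_right
  have key := card_filter_apply_eq_apply_mul_card (K := Fin r)
    (⟨e, hu⟩ : edgesAt G u) (⟨e, hv⟩ : edgesAt G v)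
  rw [card_atMostTwice, card_atMostTwice, Fintype.card_coe, Fintype.card_coe, card_edgesAt,
    card_edgesAt, Fintype.card_fin] at key
  rw [← key]
  refine Nat.mul_le_mul_right r (Finset.card_le_card_of_injOn
    (fun g => (fun x => g ⟨x.1, hsu x.2⟩, fun x => g ⟨x.1, hsv x.2⟩)) ?_ ?_)
  · intro g hg
    obtain ⟨f, hf, rfl⟩ := Finset.mem_image.1 hg
    rw [Finset.mem_coe, Finset.mem_filter, Finset.mem_product]
    exact ⟨⟨hF f hf u, hF f hf v⟩, rfl⟩
  · intro g _ g' _ hgg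
    rw [Prod.mk.injEq] at hgg
    ext1 ⟨x, hx⟩
    have hx' := hx
    rw [edgesMeeting_eq h, Finset.mem_union] at hx'
    rcases hx' with hx' | hx'
    · exact congrFun hgg.1 ⟨x, hx'⟩
    · exact congrFun hgg.2 ⟨x, hx'⟩

/-- Shearer's lemma for the stars and the double stars of a graph: vertex weights `a` give a bound
on the number of edge colorings with every color at most twice at every vertex. -/
theorem log_card_le_sum {r : ℕ} {F : Finset (G.edgeSet → Fin r)} (hne : F.Nonempty)
    (hF : ∀ f ∈ F, ∀ v, (edgesAt G v).restrict f ∈ atMostTwice (edgesAt G v) (Fin r))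
    (a : V → ℝ) (ha : ∀ v, 0 ≤ a v)
    (hw : ∀ v, ∑ e ∈ edgesAt G v, ∑ x with x ∈ e.1, a x ≤ 1 / 2 + a v) :
    Real.log F.card ≤ ∑ v, ((1 / 2 + a v) * Real.log (numAtMostTwice r (G.degree v)) -
      a v * G.degree v * Real.log r) := by
  set L : V → ℝ := fun v => Real.log (numAtMostTwice r (G.degree v))
  set W : G.edgeSet → ℝ := fun e => ∑ x with x ∈ e.1, a x
  set A : G.edgeSet ⊕ V → Finset G.edgeSet := Sum.elim (edgesMeeting G) (edgesAt G)
  -- The slack at `v` makes the cover exact: the double stars containing uv contribute the `W`-sums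
  -- at u and v minus `W` of uv, and the two slacks restore the total to 1.
  set w : G.edgeSet ⊕ V → ℝ := Sum.elim W fun v => 1 / 2 + a v - ∑ e ∈ edgesAt G v, W e
  have hw0 : ∀ j ∈ Finset.univ, 0 ≤ w j := by
    rintro (e | v) _
    · exact Finset.sum_nonneg fun x _ => ha x
    · exact sub_nonneg.2 (hw v)
  have hcov : ∀ i, ∑ j with i ∈ A j, w j = 1 := by
    rintro ⟨i, hi⟩
    induction i using Sym2.ind with | _ u v =>
    have h0 : ∑ j with (⟨s(u, v), hi⟩ : G.edgeSet) ∈ A j, w j =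
        ∑ e, (if (⟨s(u, v), hi⟩ : G.edgeSet) ∈ edgesMeeting G e then W e else 0) +
        ∑ x, (if (⟨s(u, v), hi⟩ : G.edgeSet) ∈ edgesAt G x then
          1 / 2 + a x - ∑ e ∈ edgesAt G x, W e else 0) := by
      rw [Finset.sum_filter, Fintype.sum_sum_type]
      rfl
    have h1 : ∑ e, (if (⟨s(u, v), hi⟩ : G.edgeSet) ∈ edgesMeeting G e then W e else 0) =
        ∑ e ∈ edgesAt G u ∪ edgesAt G v, W e := by
      rw [← edgesMeeting_eq hi, ← Finset.sum_filter]
      congr 1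
      ext e
      simp only [Finset.mem_filter, Finset.mem_univ, true_and, mem_edgesMeeting]
      exact exists_congr fun x => and_comm
    have h2 := Finset.sum_union_inter (s₁ := edgesAt G u) (s₂ := edgesAt G v) (f := W)
    rw [edgesAt_inter hi, Finset.sum_singleton] at h2
    simp only [mem_edgesAt] at h0
    rw [h0, ← Finset.sum_filter (fun x => x ∈ (⟨s(u, v), hi⟩ : G.edgeSet).1), sum_mem_edge hi, h1]
    have h3 : W ⟨s(u, v), hi⟩ = a u + a v := sum_mem_edge hi a
    linarith
  have hS : ∀ v, 0 < numAtMostTwice r (G.degree v) := fun v =>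
    (hne.image _).card_pos.trans_le (card_image_restrict_edgesAt_le fun f hf => hF f hf v)
  have hP : ∀ j, ((F.image (A j).restrict).card : ℝ) ≠ 0 := fun j =>
    Nat.cast_ne_zero.2 (hne.image _).card_pos.ne'
  have hP' : ∀ j, 0 < ((F.image (A j).restrict).card : ℝ) := fun j =>
    Nat.cast_pos.2 (hne.image _).card_pos
  have hshear := Real.log_le_log (Nat.cast_pos.2 hne.card_pos)
    (card_le_prod_card_image_restrict_rpow A Finset.univ w hw0 hcov F)
  rw [Real.log_prod fun j _ => (Real.rpow_pos_of_pos (hP' j) _).ne',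
    Finset.sum_congr rfl fun j _ => Real.log_rpow (hP' j) _, Fintype.sum_sum_type] at hshear
  refine hshear.trans ?_
  -- The division by `r` is shared between the endpoints according to `a`, so that the final sum
  -- splits over vertices.
  have hedge : ∀ e, w (Sum.inl e) * Real.log (F.image (A (Sum.inl e)).restrict).card ≤
      ∑ x with x ∈ e.1, (W e * L x - a x * Real.log r) := by
    rintro ⟨e, he⟩
    induction e using Sym2.ind with | _ u v =>
    rw [Finset.sum_sub_distrib, ← Finset.mul_sum, ← Finset.sum_mul, sum_mem_edge he L, ← mul_sub]
    refine mul_le_mul_of_nonneg_left ?_ (hw0 _ (Finset.mem_univ _))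
    have hr : (0 : ℝ) < r := by
      obtain ⟨f, -⟩ := hne
      exact Nat.cast_pos.2 (Fin.pos (f ⟨_, he⟩))
    rw [le_sub_iff_add_le, ← Real.log_mul (hP _) hr.ne', ← Real.log_mul
      (Nat.cast_pos.2 (hS u)).ne' (Nat.cast_pos.2 (hS v)).ne']
    refine Real.log_le_log (mul_pos (hP' _) hr) ?_
    exact_mod_cast card_image_restrict_edgesMeeting_le hF he
  have hvert : ∀ v, w (Sum.inr v) * Real.log (F.image (A (Sum.inr v)).restrict).card ≤
      (1 / 2 + a v - ∑ e ∈ edgesAt G v, W e) * L v := fun v =>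
    mul_le_mul_of_nonneg_left (Real.log_le_log (hP' _)
      (Nat.cast_le.2 (card_image_restrict_edgesAt_le fun f hf => hF f hf v)))
      (hw0 _ (Finset.mem_univ _))
  refine (add_le_add (Finset.sum_le_sum fun e _ => hedge e)
    (Finset.sum_le_sum fun v _ => hvert v)).trans (le_of_eq ?_)
  rw [sum_edges_sum_mem fun e x => W e * L x - a x * Real.log r, ← Finset.sum_add_distrib]
  refine Finset.sum_congr rfl fun v _ => ?_
  rw [Finset.sum_sub_distrib, ← Finset.sum_mul, Finset.sum_const, card_edgesAt, nsmul_eq_mul]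
  ring

end

/-! ### Logarithms of the star count and of the bound -/

theorem log_numAtMostTwice {r : ℕ} (hr : 1 ≤ r) :
    Real.log (numAtMostTwice r (2 * r - 1)) = Real.log (2 * r)! - r * Real.log 2 := by
  have h := numAtMostTwice_two_mul_mul_pow r
  rw [numAtMostTwice_two_mul hr] at h
  have hpos : (numAtMostTwice r (2 * r - 1) : ℝ) ≠ 0 := by
    intro h0
    rw [Nat.cast_eq_zero.1 h0, zero_mul] at h
    exact (Nat.factorial_pos _).ne h
  rw [← h, Nat.cast_mul, Real.log_mul hpos (by positivity), Nat.cast_pow, Real.log_pow]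
  push_cast
  ring

theorem log_starThreeBound {r : ℕ} (hr : 1 ≤ r) :
    Real.log (starThreeBound r) = (2 * r - 1) / (8 * r - 6) *
      (2 * (Real.log (2 * r)! - r * Real.log 2) - Real.log r) := by
  obtain ⟨m, rfl⟩ : ∃ m, r = m + 1 := ⟨r - 1, by omega⟩
  have hf : (((2 * (m + 1))! : ℕ) : ℝ) = 2 * (m + 1) * ((2 * (m + 1) - 1)! : ℕ) := by
    rw [show 2 * (m + 1) = (2 * m + 1) + 1 by ring, Nat.factorial_succ, Nat.add_sub_cancel]
    push_cast
    ring
  have hp : (0 : ℝ) < ((2 * (m + 1) - 1)! : ℕ) := Nat.cast_pos.2 (Nat.factorial_pos _)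
  have hm : (0 : ℝ) < m + 1 := by positivity
  rw [starThreeBound, Real.log_rpow (by positivity), hf,
    show 2 * (m + 1) - 2 = 2 * m by omega, Real.log_div (by positivity) (by positivity),
    Real.log_mul (by positivity) (by positivity), Real.log_mul (by positivity) hp.ne',
    Real.log_mul two_ne_zero hm.ne', Real.log_pow, Real.log_pow]
  push_cast
  ring

theorem starThreeBound_pos {r : ℕ} (hr : 1 ≤ r) : 0 < starThreeBound r := by
  have : (0 : ℝ) < r := by exact_mod_cast hr
  exact Real.rpow_pos_of_pos (by positivity) _

/-- Stirling makes the right side about 4r log r. It is needed at vertices of degree 2r; the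
threshold 81 = 3^4 > e^4 gives log r ≥ 4, enough to absorb the linear terms. -/
theorem le_log_numAtMostTwice {r : ℕ} (hr : 81 ≤ r) :
    (2 * r + 1) * Real.log r ≤ 2 * Real.log (numAtMostTwice r (2 * r - 1)) := by
  have hr' : (81 : ℝ) ≤ r := by exact_mod_cast hr
  have hlog : 4 ≤ Real.log r := by
    rw [Real.le_log_iff_exp_le (by linarith), show (4 : ℝ) = (4 : ℕ) * 1 by norm_num,
      Real.exp_nat_mul]
    have h3 : Real.exp 1 ≤ 3 := by linarith [Real.exp_one_lt_d9]
    calc Real.exp 1 ^ 4 ≤ (3 : ℝ) ^ 4 := by gcongr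
      _ ≤ (r : ℝ) := by linarith
  have hst := Stirling.le_log_factorial_stirling (n := 2 * r) (by omega)
  push_cast at hst
  rw [Real.log_mul two_ne_zero (by linarith)] at hst
  have h2 : 0 < Real.log 2 := Real.log_pos (by norm_num)
  have hpi : 0 ≤ Real.log (2 * Real.pi) := Real.log_nonneg (by linarith [Real.pi_gt_three])
  rw [log_numAtMostTwice (by omega)]
  nlinarith [mul_pos h2 (by linarith : (0 : ℝ) < r)]

/-! ### Choice of vertex weights -/

section
variable {V : Type*} [Fintype V] [DecidableEq V] {G : SimpleGraph V} [DecidableRel G.Adj]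

theorem degree_le_of_mem_atMostTwice {r : ℕ} {f : G.edgeSet → Fin r} {v : V}
    (hf : (edgesAt G v).restrict f ∈ atMostTwice (edgesAt G v) (Fin r)) :
    G.degree v ≤ 2 * r := by
  have h := sum_deficit hf
  rw [Fintype.card_coe, card_edgesAt, Fintype.card_fin] at h
  omega

theorem sum_mem_edge_le {v : V} {a : V → ℝ} {M : ℝ} (ha : ∀ x, a x ≤ M) {e : G.edgeSet}
    (he : e ∈ edgesAt G v) : ∑ x with x ∈ e.1, a x ≤ a v + M := by
  rw [mem_edgesAt] at he
  obtain ⟨e, h⟩ := e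
  induction e using Sym2.ind with | _ u w =>
  rw [sum_mem_edge h]
  rcases Sym2.mem_iff.1 he with rfl | rfl
  · linarith [ha w]
  · linarith [ha u]

/-- The number of edge colorings with every color at most twice at every vertex. -/
theorem log_card_le_card_mul_log_starThreeBound {r : ℕ} (hr : 81 ≤ r)
    {F : Finset (G.edgeSet → Fin r)} (hne : F.Nonempty)
    (hF : ∀ f ∈ F, ∀ v, (edgesAt G v).restrict f ∈ atMostTwice (edgesAt G v) (Fin r)) :
    Real.log F.card ≤ Fintype.card V * Real.log (starThreeBound r) := by
  have hr' : (81 : ℝ) ≤ r := by exact_mod_cast hr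
  have hdeg : ∀ v, G.degree v ≤ 2 * r := fun v => by
    obtain ⟨f, hf⟩ := hne
    exact degree_le_of_mem_atMostTwice (hF f hf v)
  have hSpos : ∀ v, (0 : ℝ) < numAtMostTwice r (G.degree v) := fun v => Nat.cast_pos.2 <|
    (hne.image _).card_pos.trans_le (card_image_restrict_edgesAt_le fun f hf => hF f hf v)
  -- `α` solves (2r-1)·2α = 1/2 + α and `β` solves 2r(α + β) = 1/2 + β: zero slack at degrees 2r-1
  -- and 2r when all neighbors have weight `α`.
  obtain ⟨α, hα⟩ : ∃ α : ℝ, α * (8 * r - 6) = 1 :=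
    ⟨1 / (8 * r - 6), one_div_mul_cancel (by linarith)⟩
  obtain ⟨β, hβ⟩ : ∃ β : ℝ, β * (2 * r - 1) = α * (2 * r - 3) :=
    ⟨α * (2 * r - 3) / (2 * r - 1), div_mul_cancel₀ _ (by linarith)⟩
  have hα0 : 0 < α := pos_of_mul_pos_left (by rw [hα]; exact one_pos) (by linarith)
  have hβ0 : 0 ≤ β := nonneg_of_mul_nonneg_left
    (by rw [hβ]; exact mul_nonneg hα0.le (by linarith)) (by linarith : (0 : ℝ) < 2 * r - 1)
  have hβα : β ≤ α := by
    refine le_of_mul_le_mul_right ?_ (by linarith : (0 : ℝ) < 2 * r - 1)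
    rw [hβ]
    nlinarith
  set a : V → ℝ := fun v => if G.degree v ≤ 2 * r - 1 then α else β
  have ha0 : ∀ v, 0 ≤ a v := fun v => by simp only [a]; split_ifs <;> [exact hα0.le; exact hβ0]
  have haα : ∀ v, a v ≤ α := fun v => by simp only [a]; split_ifs <;> [exact le_rfl; exact hβα]
  refine (log_card_le_sum hne hF a ha0 fun v => ?_).trans ?_
  · refine (Finset.sum_le_card_nsmul _ _ _ fun e he => sum_mem_edge_le haα he).trans ?_
    rw [card_edgesAt, nsmul_eq_mul]
    simp only [a]
    split_ifs with h
    · have h' : (G.degree v : ℝ) ≤ 2 * r - 1 := by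
        rw [le_sub_iff_add_le]; exact_mod_cast (by omega : G.degree v + 1 ≤ 2 * r)
      nlinarith
    · have h' : (G.degree v : ℝ) = 2 * r := by
        exact_mod_cast (by have := hdeg v; omega : G.degree v = 2 * r)
      rw [h']
      nlinarith
  · rw [← nsmul_eq_mul, ← Finset.card_univ, ← Finset.sum_const]
    refine Finset.sum_le_sum fun v _ => ?_
    rw [log_starThreeBound (by omega), ← log_numAtMostTwice (by omega),
      show (2 * r - 1 : ℝ) / (8 * r - 6) = (2 * r - 1) * α by
        rw [div_eq_iff (by linarith), mul_assoc, hα, mul_one]]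
    have hS := le_log_numAtMostTwice hr
    set L := Real.log (numAtMostTwice r (2 * r - 1))
    set l := Real.log r
    simp only [a]
    split_ifs with h
    · obtain ⟨k, hk⟩ := Nat.exists_eq_add_of_le h
      have hk' : (G.degree v : ℝ) = 2 * r - 1 - k := by
        have : ((G.degree v + k + 1 : ℕ) : ℝ) = (2 * r : ℕ) := by congr 1; omega
        push_cast at this
        linarith
      have hpow := numAtMostTwice_mul_pow_le (r := r) (d := G.degree v) k (by omega) (by omega)
      rw [← hk] at hpow
      have hlog := Real.log_le_log (mul_pos (hSpos v) (by positivity)) hpow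
      rw [Real.log_mul (hSpos v).ne' (by positivity), Real.log_pow] at hlog
      have h32 : (1 / 3 : ℝ) ≤ Real.log (3 / 2) := by
        have := Real.one_sub_inv_le_log_of_pos (show (0 : ℝ) < 3 / 2 by norm_num)
        norm_num at this ⊢
        exact this
      -- Per missing edge, the gain `α` log r must not exceed the loss (1/2 + `α`) log(3/2), where
      -- 1/2 + `α` = (4r-2)`α`.
      have hl : l ≤ (4 * r - 2) * Real.log (3 / 2) := by
        have := Real.log_le_self (show (0 : ℝ) ≤ r by linarith)
        nlinarith
      set q := Real.log (3 / 2)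
      set M := Real.log (numAtMostTwice r (G.degree v))
      have hhalf : 1 / 2 + α = (4 * r - 2) * α := by linarith
      have h1 : (4 * r - 2) * α * (M + k * q) ≤ (4 * r - 2) * α * L :=
        mul_le_mul_of_nonneg_left hlog (mul_nonneg (by linarith) hα0.le)
      have h2 : α * k * l ≤ α * k * ((4 * r - 2) * q) :=
        mul_le_mul_of_nonneg_left hl (by positivity)
      rw [hhalf, hk']
      linarith
    · have hd : G.degree v = 2 * r := by have := hdeg v; omega
      rw [hd, numAtMostTwice_two_mul (by omega)]
      push_cast
      have hβ' : (2 * r - 1) * (α - β) = 2 * α := by linarith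
      -- Half of this product is exactly the margin by which a degree-2r vertex falls below the
      -- bound.
      have h1 : 0 ≤ (α - β) * (2 * L - (2 * r + 1) * l) :=
        mul_nonneg (by linarith) (by linarith)
      have hhalf : 1 / 2 + β = (4 * r - 2) * α - (α - β) := by linarith
      have h2 : β * (2 * r) = (2 * r - 1) * α - (α - β) * (2 * r + 1) / 2 := by
        linarith
      change (1 / 2 + β) * L - β * (2 * r) * l ≤ _
      rw [hhalf, h2]
      linarith

end

/-! ### Good colorings and existence of the limit -/

/-- A graph contains no star with three edges iff every vertex has at most two neighbors. -/
theorem starWithEdges_three_free_iff {V : Type*} {G : SimpleGraph V} :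
    (starWithEdges 3).Free G ↔
      ∀ v x y z, G.Adj v x → G.Adj v y → G.Adj v z → x = y ∨ x = z ∨ y = z := by
  constructor
  · intro h v x y z hx hy hz
    by_contra hne
    push Not at hne
    obtain ⟨hxy, hxz, hyz⟩ := hne
    refine h ⟨⟨⟨![v, x, y, z], ?_⟩, ?_⟩⟩
    · intro a b hab
      rw [starWithEdges, SimpleGraph.starGraph_adj] at hab
      fin_cases a <;> fin_cases b <;> simp_all [SimpleGraph.adj_comm]
    · intro a b hab
      have h1 := hx.ne
      have h2 := hy.ne
      have h3 := hz.ne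
      fin_cases a <;> fin_cases b <;> simp_all [eq_comm]
  · rintro h ⟨f⟩
    have hadj : ∀ i : Fin 4, i ≠ 0 → G.Adj (f 0) (f i) := fun i hi =>
      f.toHom.map_adj (SimpleGraph.starGraph_center_adj hi.symm)
    have hinj := f.injective
    rcases h (f 0) (f 1) (f 2) (f 3) (hadj 1 (by decide)) (hadj 2 (by decide))
      (hadj 3 (by decide)) with h | h | h
    · exact absurd (hinj h) (by decide)
    · exact absurd (hinj h) (by decide)
    · exact absurd (hinj h) (by decide)

theorem restrict_mem_atMostTwice {V : Type*} [Fintype V] [DecidableEq V] {G : SimpleGraph V}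
    [DecidableRel G.Adj] {r : ℕ} {C : G.EdgeLabeling (Fin r)}
    (hC : ∀ i, (starWithEdges 3).Free (C.labelGraph i)) (v : V) :
    (edgesAt G v).restrict C ∈ atMostTwice (edgesAt G v) (Fin r) := by
  rw [mem_atMostTwice]
  intro c
  by_contra hcard
  rw [not_le, Finset.two_lt_card] at hcard
  obtain ⟨e₁, h₁, e₂, h₂, e₃, h₃, h₁₂, h₁₃, h₂₃⟩ := hcard
  have key : ∀ e : edgesAt G v, e ∈ Finset.univ.filter
      (fun e => (edgesAt G v).restrict C e = c) →
      ∃ x, e.1.1 = s(v, x) ∧ (C.labelGraph c).Adj v x := by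
    rintro ⟨⟨e, he⟩, hv⟩ hc
    obtain ⟨x, rfl⟩ := Sym2.mem_iff_exists.1 (mem_edgesAt.1 hv)
    rw [Finset.mem_filter] at hc
    exact ⟨x, rfl, (SimpleGraph.EdgeLabeling.labelGraph_adj v x).2 ⟨he, hc.2⟩⟩
  obtain ⟨x, hx, hvx⟩ := key e₁ h₁
  obtain ⟨y, hy, hvy⟩ := key e₂ h₂
  obtain ⟨z, hz, hvz⟩ := key e₃ h₃
  rcases starWithEdges_three_free_iff.1 (hC c) v x y z hvx hvy hvz with rfl | rfl | rfl
  · exact h₁₂ (Subtype.ext (Subtype.ext (hx.trans hy.symm)))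
  · exact h₁₃ (Subtype.ext (Subtype.ext (hx.trans hz.symm)))
  · exact h₂₃ (Subtype.ext (Subtype.ext (hy.trans hz.symm)))

theorem log_numGoodColorings_le {V : Type*} [Fintype V] (G : SimpleGraph V) {r : ℕ}
    (hr : 81 ≤ r) (hpos : numGoodColorings r (starWithEdges 3) G ≠ 0) :
    Real.log (numGoodColorings r (starWithEdges 3) G) ≤
      Fintype.card V * Real.log (starThreeBound r) := by
  classical
  set F : Finset (G.edgeSet → Fin r) := Finset.univ.filter fun C =>
    ∀ i, (starWithEdges 3).Free (SimpleGraph.EdgeLabeling.labelGraph (G := G) C i)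
  have hF : numGoodColorings r (starWithEdges 3) G = F.card := by
    rw [numGoodColorings]
    exact Nat.subtype_card F fun C => by simp [F]
  rw [hF] at hpos ⊢
  refine log_card_le_card_mul_log_starThreeBound hr
    (Finset.card_pos.1 (Nat.pos_of_ne_zero hpos)) fun f hf v => ?_
  exact restrict_mem_atMostTwice (Finset.mem_filter.1 hf).2 v

theorem numGoodColorings_le_of_iso {V V' : Type*} [Finite V] {G : SimpleGraph V}
    {G' : SimpleGraph V'} (e : G ≃g G') (r : ℕ) :
    numGoodColorings r (starWithEdges 3) G' ≤ numGoodColorings r (starWithEdges 3) G := by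
  refine Nat.card_le_card_of_injective
    (fun C => ⟨C.1.pullback e.toHom, fun i => ?_⟩) fun C C' h => ?_
  · have hC := starWithEdges_three_free_iff.1 (C.2 i)
    refine starWithEdges_three_free_iff.2 fun v x y z hx hy hz => ?_
    rw [SimpleGraph.EdgeLabeling.labelGraph_adj] at hx hy hz
    have hadj : ∀ u w, (∃ h : G.Adj u w, C.1.pullback e.toHom ⟨s(u, w), h⟩ = i) →
        (C.1.labelGraph i).Adj (e u) (e w) := fun u w h =>
      (SimpleGraph.EdgeLabeling.labelGraph_adj _ _).2 ⟨e.toHom.map_adj h.1, h.2⟩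
    simpa using hC _ _ _ _ (hadj _ _ hx) (hadj _ _ hy) (hadj _ _ hz)
  · refine Subtype.ext (funext fun d => ?_)
    obtain ⟨d, rfl⟩ := e.mapEdgeSet.surjective d
    exact congrFun (congrArg Subtype.val h) d

/-- Color the two sides independently: no edge joins them, so the neighbors of a vertex all lie on
its own side. -/
theorem numGoodColorings_mul_le_sum {V W : Type*} [Finite V] [Finite W] (G : SimpleGraph V)
    (G' : SimpleGraph W) (r : ℕ) :
    numGoodColorings r (starWithEdges 3) G * numGoodColorings r (starWithEdges 3) G' ≤
      numGoodColorings r (starWithEdges 3) (G ⊕g G') := by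
  rw [numGoodColorings, numGoodColorings, ← Nat.card_prod]
  refine Nat.card_le_card_of_injective
    (fun p => ⟨fun e => Sum.elim p.1.1 p.2.1 (SimpleGraph.edgeSetSumEquiv e), fun i => ?_⟩)
    fun p p' h => ?_
  · have h1 := starWithEdges_three_free_iff.1 (p.1.2 i)
    have h2 := starWithEdges_three_free_iff.1 (p.2.2 i)
    refine starWithEdges_three_free_iff.2 fun v x y z hx hy hz => ?_
    obtain ⟨hx, hx'⟩ := (SimpleGraph.EdgeLabeling.labelGraph_adj _ _).1 hx
    obtain ⟨hy, hy'⟩ := (SimpleGraph.EdgeLabeling.labelGraph_adj _ _).1 hy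
    obtain ⟨hz, hz'⟩ := (SimpleGraph.EdgeLabeling.labelGraph_adj _ _).1 hz
    rcases v with v | v <;> rcases x with x | x <;> try (simp at hx; done)
    all_goals rcases y with y | y <;> try (simp at hy; done)
    all_goals rcases z with z | z <;> try (simp at hz; done)
    · simpa using h1 v x y z ((SimpleGraph.EdgeLabeling.labelGraph_adj _ _).2 ⟨hx, hx'⟩)
        ((SimpleGraph.EdgeLabeling.labelGraph_adj _ _).2 ⟨hy, hy'⟩)
        ((SimpleGraph.EdgeLabeling.labelGraph_adj _ _).2 ⟨hz, hz'⟩)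
    · simpa using h2 v x y z ((SimpleGraph.EdgeLabeling.labelGraph_adj _ _).2 ⟨hx, hx'⟩)
        ((SimpleGraph.EdgeLabeling.labelGraph_adj _ _).2 ⟨hy, hy'⟩)
        ((SimpleGraph.EdgeLabeling.labelGraph_adj _ _).2 ⟨hz, hz'⟩)
  · have h' := fun e => congrFun (congrArg Subtype.val h) (SimpleGraph.edgeSetSumEquiv.symm e)
    simp only [Equiv.apply_symm_apply] at h'
    refine Prod.ext (Subtype.ext (funext fun e => ?_)) (Subtype.ext (funext fun e => ?_))
    · exact h' (Sum.inl e)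
    · exact h' (Sum.inr e)

theorem bddAbove_numGoodColorings (r n : ℕ) :
    BddAbove (Set.range fun G : SimpleGraph (Fin n) =>
      numGoodColorings r (starWithEdges 3) G) := (Set.finite_range _).bddAbove

theorem exists_numGoodColorings_eq_max (r n : ℕ) : ∃ G : SimpleGraph (Fin n),
    numGoodColorings r (starWithEdges 3) G = maxGoodColorings r (starWithEdges 3) n :=
  exists_eq_ciSup_of_finite

theorem maxGoodColorings_pos (r n : ℕ) : 0 < maxGoodColorings r (starWithEdges 3) n := by
  refine lt_of_lt_of_le ?_ (le_ciSup (bddAbove_numGoodColorings r n) ⊥)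
  have : IsEmpty (⊥ : SimpleGraph (Fin n)).edgeSet := by simp
  refine Nat.card_pos_iff.2 ⟨⟨⟨fun e => isEmptyElim e, fun i => ?_⟩⟩, inferInstance⟩
  refine starWithEdges_three_free_iff.2 fun v x y z hx hy hz => ?_
  exact absurd (SimpleGraph.EdgeLabeling.labelGraph_le _ hx) (by simp)

theorem maxGoodColorings_mul_le (r m n : ℕ) :
    maxGoodColorings r (starWithEdges 3) m * maxGoodColorings r (starWithEdges 3) n ≤
      maxGoodColorings r (starWithEdges 3) (m + n) := by
  obtain ⟨G, hG⟩ := exists_numGoodColorings_eq_max r m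
  obtain ⟨G', hG'⟩ := exists_numGoodColorings_eq_max r n
  rw [← hG, ← hG']
  refine (numGoodColorings_mul_le_sum G G' r).trans ?_
  exact (numGoodColorings_le_of_iso
    (SimpleGraph.Iso.comap finSumFinEquiv.symm (G ⊕g G')) r).trans
    (le_ciSup (bddAbove_numGoodColorings r (m + n)) _)

theorem log_maxGoodColorings_le {r : ℕ} (hr : 81 ≤ r) (n : ℕ) :
    Real.log (maxGoodColorings r (starWithEdges 3) n) ≤ n * Real.log (starThreeBound r) := by
  obtain ⟨G, hG⟩ := exists_numGoodColorings_eq_max r n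
  have h := log_numGoodColorings_le G hr (by rw [hG]; exact (maxGoodColorings_pos r n).ne')
  rwa [hG, Fintype.card_fin] at h

theorem coloringRoot_eq (r n : ℕ) : coloringRoot r (starWithEdges 3) n =
    ENNReal.ofReal
      (Real.exp (Real.log (maxGoodColorings r (starWithEdges 3) n) / n)) := by
  have hpos : (0 : ℝ) < maxGoodColorings r (starWithEdges 3) n :=
    Nat.cast_pos.2 (maxGoodColorings_pos r n)
  rw [coloringRoot, ← ENNReal.ofReal_natCast, ENNReal.ofReal_rpow_of_pos hpos,
    Real.rpow_def_of_pos hpos, mul_one_div]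

/-- By Fekete's lemma the limit exists, and it is at most the bound for every single `n`. -/
theorem tendsto_coloringRoot_and_growth_le {r : ℕ} (hr : 81 ≤ r) :
    Tendsto (coloringRoot r (starWithEdges 3)) atTop
        (𝓝 (coloringGrowth r (starWithEdges 3))) ∧
      coloringGrowth r (starWithEdges 3) ≤ ENNReal.ofReal (starThreeBound r) := by
  set u : ℕ → ℝ := fun n => -Real.log (maxGoodColorings r (starWithEdges 3) n)
  have hpos : ∀ n, (0 : ℝ) < maxGoodColorings r (starWithEdges 3) n := fun n =>
    Nat.cast_pos.2 (maxGoodColorings_pos r n)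
  have hsub : Subadditive u := by
    intro m n
    simp only [u]
    rw [← neg_add, neg_le_neg_iff, ← Real.log_mul (hpos m).ne' (hpos n).ne']
    refine Real.log_le_log (mul_pos (hpos m) (hpos n)) ?_
    exact_mod_cast maxGoodColorings_mul_le r m n
  have hle : ∀ n, 0 < n →
      Real.log (maxGoodColorings r (starWithEdges 3) n) / n ≤ Real.log (starThreeBound r) := by
    intro n hn
    rw [div_le_iff₀' (Nat.cast_pos.2 hn)]
    exact log_maxGoodColorings_le hr n
  have hbdd : BddBelow (Set.range fun n => u n / n) := by
    -- The 0 covers n = 0, where `u n / n` is 0 by convention.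
    refine ⟨min 0 (-Real.log (starThreeBound r)), ?_⟩
    rintro _ ⟨n, rfl⟩
    rcases Nat.eq_zero_or_pos n with rfl | hn
    · simp
    · refine (min_le_right _ _).trans ?_
      simp only [u, neg_div]
      exact neg_le_neg (hle n hn)
  have hlim : Tendsto (coloringRoot r (starWithEdges 3)) atTop
      (𝓝 (ENNReal.ofReal (Real.exp (-hsub.lim)))) := by
    simp only [funext (coloringRoot_eq r)]
    refine (ENNReal.continuous_ofReal.tendsto _).comp
      ((Real.continuous_exp.tendsto _).comp ?_)
    refine (hsub.tendsto_lim hbdd).neg.congr fun n => ?_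
    simp only [u]
    ring
  have hgrowth : coloringGrowth r (starWithEdges 3) = ENNReal.ofReal (Real.exp (-hsub.lim)) :=
    hlim.limUnder_eq
  rw [hgrowth]
  refine ⟨hlim, le_of_tendsto hlim ((eventually_gt_atTop 0).mono fun n hn => ?_)⟩
  rw [coloringRoot_eq]
  refine ENNReal.ofReal_le_ofReal ?_
  rw [← Real.le_log_iff_exp_le (starThreeBound_pos (by omega))]
  exact hle n hn

/-! ### Asymptotics of the bound -/

/-- The logarithm of the quotient of the bound and its asymptotic form. -/
theorem log_starThreeBound_sub {r : ℕ} (hr : 1 ≤ r) :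
    Real.log (starThreeBound r) - Real.log ((2 : ℝ) ^ (1 / 8 : ℝ) / Real.exp 1 ^ (1 / 4 : ℝ) *
      (((2 * r)! : ℝ) / 2 ^ r) ^ (1 / 2 : ℝ)) =
    (2 * Real.log (Stirling.stirlingSeq (2 * r)) + (7 / 2 * Real.log 2 - 3) + 3 * Real.log r) /
      (16 * r - 12) := by
  have hr' : (1 : ℝ) ≤ r := by exact_mod_cast hr
  have hf : (0 : ℝ) < (2 * r)! := Nat.cast_pos.2 (Nat.factorial_pos _)
  have hst := Stirling.log_stirlingSeq_formula (2 * r)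
  push_cast at hst
  rw [Real.log_div (by linarith) (Real.exp_pos 1).ne', Real.log_exp,
    Real.log_mul two_ne_zero (by linarith), Real.log_mul two_ne_zero (by linarith)] at hst
  rw [log_starThreeBound hr, Real.log_mul (by positivity) (by positivity),
    Real.log_div (by positivity) (by positivity), Real.log_rpow two_pos,
    Real.log_rpow (Real.exp_pos 1), Real.log_exp, Real.log_rpow (by positivity),
    Real.log_div hf.ne' (by positivity), Real.log_pow]
  have h8 : (8 * r - 6 : ℝ) ≠ 0 := by linarith
  have h : (2 * r - 1 : ℝ) / (8 * r - 6) * (8 * r - 6) = 2 * r - 1 := div_mul_cancel₀ _ h8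
  rw [eq_div_iff (by linarith)]
  linear_combination
    2 * (2 * (Real.log (2 * r)! - r * Real.log 2) - Real.log r) * h - 2 * hst

theorem tendsto_log_starThreeBound_sub :
    Tendsto (fun r : ℕ => Real.log (starThreeBound r) -
      Real.log ((2 : ℝ) ^ (1 / 8 : ℝ) / Real.exp 1 ^ (1 / 4 : ℝ) *
        (((2 * r)! : ℝ) / 2 ^ r) ^ (1 / 2 : ℝ))) atTop (𝓝 0) := by
  have hs : Tendsto (fun r : ℕ => Real.log (Stirling.stirlingSeq (2 * r))) atTop
      (𝓝 (Real.log √Real.pi)) :=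
    ((Stirling.tendsto_stirlingSeq_sqrt_pi.comp
      (tendsto_id.const_mul_atTop' (by norm_num : 0 < 2))).log
      (Real.sqrt_pos.2 Real.pi_pos).ne')
  have h1 : Tendsto (fun r : ℕ => (2 * Real.log (Stirling.stirlingSeq (2 * r)) +
      (7 / 2 * Real.log 2 - 3)) / (r : ℝ)) atTop (𝓝 0) :=
    ((hs.const_mul 2).add_const _).div_atTop tendsto_natCast_atTop_atTop
  have h2 : Tendsto (fun r : ℕ => 3 * (Real.log r / (r : ℝ))) atTop (𝓝 0) := by
    simpa using (Real.isLittleO_log_id_atTop.tendsto_div_nhds_zero.comp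
      tendsto_natCast_atTop_atTop).const_mul 3
  have h3 := (h1.add h2).norm
  rw [add_zero, norm_zero] at h3
  refine squeeze_zero_norm' ((eventually_ge_atTop 1).mono fun r hr => ?_) h3
  have hr' : (1 : ℝ) ≤ r := by exact_mod_cast hr
  rw [log_starThreeBound_sub hr, ← mul_div_assoc, ← add_div, norm_div, norm_div]
  -- The denominator 16r - 12 is at least r once r ≥ 1.
  refine div_le_div_of_nonneg_left (norm_nonneg _)
    (norm_pos_iff.2 (by linarith)) ?_
  rw [Real.norm_of_nonneg (by linarith), Real.norm_of_nonneg (by linarith)]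
  linarith

theorem starThreeBound_isEquivalent : starThreeBound ~[atTop]
    (fun r : ℕ => (2 : ℝ) ^ (1 / 8 : ℝ) / Real.exp 1 ^ (1 / 4 : ℝ) *
      (((2 * r)! : ℝ) / 2 ^ r) ^ (1 / 2 : ℝ)) := by
  have hpos : ∀ r : ℕ, 0 < (2 : ℝ) ^ (1 / 8 : ℝ) / Real.exp 1 ^ (1 / 4 : ℝ) *
      (((2 * r)! : ℝ) / 2 ^ r) ^ (1 / 2 : ℝ) := fun r => by
    have hf : (0 : ℝ) < (2 * r)! := Nat.cast_pos.2 (Nat.factorial_pos _)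
    positivity
  refine isEquivalent_of_tendsto_one ?_
  have h := (Real.continuous_exp.tendsto 0).comp tendsto_log_starThreeBound_sub
  rw [Real.exp_zero] at h
  refine h.congr' ((eventually_ge_atTop 1).mono fun r hr => ?_)
  simp only [Function.comp_apply, Pi.div_apply]
  rw [Real.exp_sub, Real.exp_log (starThreeBound_pos hr), Real.exp_log (hpos r)]

theorem abs_two_rpow_div_exp_rpow_sub_lt :
    |(2 : ℝ) ^ (1 / 8 : ℝ) / Real.exp 1 ^ (1 / 4 : ℝ) - 0.85| < 0.005 := by
  set q := (2 : ℝ) ^ (1 / 8 : ℝ) / Real.exp 1 ^ (1 / 4 : ℝ) with hq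
  have hq0 : 0 ≤ q := by positivity
  -- The eighth power clears both roots, leaving only decimal bounds on e.
  have hq8 : q ^ 8 = 2 / Real.exp 1 ^ 2 := by
    rw [hq, div_pow, ← Real.rpow_natCast, ← Real.rpow_natCast, ← Real.rpow_mul two_pos.le,
      ← Real.rpow_mul (Real.exp_pos 1).le, ← Real.rpow_natCast]
    norm_num
  have hl : (2.71 : ℝ) < Real.exp 1 := lt_trans (by norm_num) Real.exp_one_gt_d9
  have hu : Real.exp 1 < (2.72 : ℝ) := lt_trans Real.exp_one_lt_d9 (by norm_num)
  have h1 : 0.845 < q := by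
    refine lt_of_pow_lt_pow_left₀ 8 hq0 ?_
    rw [hq8, lt_div_iff₀ (by positivity)]
    calc (0.845 : ℝ) ^ 8 * Real.exp 1 ^ 2 ≤ 0.845 ^ 8 * 2.72 ^ 2 := by gcongr
      _ < 2 := by norm_num
  have h2 : q < 0.855 := by
    refine lt_of_pow_lt_pow_left₀ 8 (by norm_num) ?_
    rw [hq8, div_lt_iff₀ (by positivity)]
    calc (2 : ℝ) < 0.855 ^ 8 * 2.71 ^ 2 := by norm_num
      _ ≤ 0.855 ^ 8 * Real.exp 1 ^ 2 := by gcongr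
  rw [abs_lt]
  constructor <;> linarith

theorem theorem5 :
    (∃ r₀ : ℕ, ∀ r : ℕ, r₀ ≤ r →
      Tendsto (coloringRoot r (starWithEdges 3)) atTop
        (𝓝 (coloringGrowth r (starWithEdges 3))) ∧
      coloringGrowth r (starWithEdges 3) ≤ ENNReal.ofReal (starThreeBound r)) ∧
    starThreeBound ~[atTop]
      (fun r : ℕ => (2 : ℝ) ^ (1 / 8 : ℝ) / Real.exp 1 ^ (1 / 4 : ℝ) *
        (((2 * r)! : ℝ) / 2 ^ r) ^ (1 / 2 : ℝ)) ∧
    |(2 : ℝ) ^ (1 / 8 : ℝ) / Real.exp 1 ^ (1 / 4 : ℝ) - 0.85| < 0.005 :=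
  ⟨⟨81, fun _ hr => tendsto_coloringRoot_and_growth_le hr⟩, starThreeBound_isEquivalent,
    abs_two_rpow_div_exp_rpow_sub_lt⟩
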